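/- Let $k,\kappa\ge 0$ be integers and $n=k+\kappa\ge 1$. Let $G\in\mathbb F_2^{\kappa\times n}$ and $G'\in\mathbb F_2^{k\times n}$ be matrices whose $n$ rows together are linearly independent over $\mathbb F_2$. The corresponding coset code encodes a uniformly distributed message $M\in\mathbb F_2^{k}$ as $X=MG'+M'G$, where $M'\in\mathbb F_2^{\kappa}$ is uniform and independent of $M$. An eavesdropper observes $Z\in\{0,1,?\}^n$, where $Z_i=X_i$ if $i$ lies in a random set $R\subseteq\{1,\dots,n\}$ of revealed positions, independent of $(M,M')$, and $Z_i={?}$ otherwise. Consider the $\chi^2$ divergence $$\sum_{m,z}\Big(\frac{p_{MZ}(m,z)}{p_M(m)p_Z(z)}-1\Big)^2p_M(m)\,p_Z(z)$$ (terms with $p_Z(z)=0$ count as $0$) between the joint distribution $p_{MZ}$ and the product $p_Mp_Z$ of its marginals. Denote it by $\Lambda(n,\mu,q)$ if $\mu$ bits are revealed, i.e. $R$ is uniform among the $\mu$-element subsets of $\{1,\dots,n\}$, where $0\le\mu\le n$. Denote it by $\lambda(n,\epsilon,q)$ for the erasure probability $\epsilon\in[0,1]$, i.e. if each position is erased independently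 with probability $\epsilon$. Here $q=(q_0,\dots,q_{2^\kappa-1})$ is the vector that defines the code: $q_i$ is the fraction of the $n$ columns of $G$ that are equal to the vector $\nu(i)\in W=\mathbb F_2^\kappa$ of the binary digits of $i$ (least significant first). For a subspace $S\subseteq W$ put $$\zeta(S)=\sum_{i:\,\nu(i)\in S}q_i,\qquad \Phi(S)=\prod_{i=0}^{\mu-1}\frac{\zeta(S)-\frac in}{1-\frac in},\qquad \varphi(S)=\Big(\frac{\epsilon}{2-\epsilon}\Big)^{n(1-\zeta(S))},$$ and let $\Xi(W,\kappa-1)$ be the set of $(\kappa-1)$-dimensional subspaces of $W$ (empty if $\kappa=0$). Then, for every $0\le\mu\le n$ and every $0\le\epsilon\le1$, $$\Lambda(n,\mu,q)=2^{\mu-\kappa}\Big(1+\sum_{S\in\Xi(W,\kappa-1)}\Phi(S)\Big)-1,$$ $$\lambda(n,\epsilon,q)=(2-\epsilon)^n2^{-\kappa}\Big(1+\sum_{S\in\Xi(W,\kappa-1)}\varphi(S)\Big)-1 .$$ -/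

import Mathlib

open scoped Matrix

/-- A coset code with `k` message bits, base code of dimension `κ` and blocklength `n = k + κ`:
a `κ × n` generator matrix `gen` of the base code and a `k × n` auxiliary matrix `aux`, such that
the rows of the two matrices together are linearly independent
(so `gen` in particular has full rank). -/
structure CosetCode (k κ n : ℕ) where
  /-- the auxiliary generator matrix, whose row space represents the cosets -/
  aux : Matrix (Fin k) (Fin n) (ZMod 2)
  /-- the generator matrix of the base code -/
  gen : Matrix (Fin κ) (Fin n) (ZMod 2)
  dim_add : k + κ = n
  indep : LinearIndependent (ZMod 2) (Matrix.fromRows aux gen).row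

/-- The codeword sent for the message `m` and the auxiliary message `m'`. -/
def CosetCode.encode {k κ n : ℕ} (C : CosetCode k κ n)
    (m : Fin k → ZMod 2) (m' : Fin κ → ZMod 2) : Fin n → ZMod 2 :=
  Sum.elim m m' ᵥ* Matrix.fromRows C.aux C.gen

/-- The eavesdropper's observation of `x` when exactly the positions in `r` are revealed;
`none` is the erasure symbol `?`. -/
def observe {n : ℕ} (r : Finset (Fin n)) (x : Fin n → ZMod 2) : Fin n → Option (ZMod 2) :=
  fun i => if i ∈ r then some (x i) else none

/-- The law of the set of revealed positions for a binary erasure channel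
with erasure probability `ε`. -/
def erasureLaw (n : ℕ) (ε : ℝ) (r : Finset (Fin n)) : ℝ :=
  ε ^ (n - r.card) * (1 - ε) ^ r.card

/-- The law of the set of revealed positions, given that exactly `μ` positions are revealed:
uniform on the `μ`-element sets. -/
noncomputable def fixedLaw (n μ : ℕ) (r : Finset (Fin n)) : ℝ :=
  if r.card = μ then 1 / (n.choose μ : ℝ) else 0

/-- `fixedLaw` is the conditional law of the revealed set of the binary erasure channel
given that `μ` positions are revealed. -/
theorem fixedLaw_eq_cond {n μ : ℕ} {ε : ℝ} (h0 : 0 < ε) (h1 : ε < 1) (r : Finset (Fin n)) :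
    fixedLaw n μ r = (if r.card = μ then erasureLaw n ε r else 0) /
      ∑ s : Finset (Fin n), if s.card = μ then erasureLaw n ε s else 0 := by
  have hs : (∑ s : Finset (Fin n), if s.card = μ then erasureLaw n ε s else 0)
      = (n.choose μ : ℝ) * (ε ^ (n - μ) * (1 - ε) ^ μ) := by
    rw [← Finset.sum_filter, Finset.sum_congr rfl (g := fun _ => ε ^ (n - μ) * (1 - ε) ^ μ)]
    · have hc : (Finset.univ.filter fun s : Finset (Fin n) => s.card = μ)
          = Finset.powersetCard μ Finset.univ := by
        ext s; simp [Finset.mem_powersetCard]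
      rw [Finset.sum_const, hc, Finset.card_powersetCard, Finset.card_univ, Fintype.card_fin,
        nsmul_eq_mul]
    · intro s hs
      simp only [Finset.mem_filter] at hs
      simp [erasureLaw, hs.2]
  rw [hs, fixedLaw]
  split_ifs with h
  · have hpos : 0 < ε ^ (n - μ) * (1 - ε) ^ μ := by
      have : 0 < 1 - ε := by linarith
      positivity
    rw [erasureLaw, h, mul_comm (n.choose μ : ℝ), ← div_div, div_self hpos.ne']
  · simp

/-- The joint distribution of the message `M` and the observation `Z`: message and auxiliary
message are uniform and independent of each other and of the revealed set, which has law `w`. -/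
noncomputable def CosetCode.joint {k κ n : ℕ} (C : CosetCode k κ n) (w : Finset (Fin n) → ℝ)
    (m : Fin k → ZMod 2) (z : Fin n → Option (ZMod 2)) : ℝ :=
  ∑ m' : Fin κ → ZMod 2, ∑ r : Finset (Fin n),
    if observe r (C.encode m m') = z then 1 / 2 ^ k * (1 / 2 ^ κ) * w r else 0

/-- The marginal distribution of the message. -/
noncomputable def CosetCode.margM {k κ n : ℕ} (C : CosetCode k κ n) (w : Finset (Fin n) → ℝ)
    (m : Fin k → ZMod 2) : ℝ :=
  ∑ z : Fin n → Option (ZMod 2), C.joint w m z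

/-- The marginal distribution of the observation. -/
noncomputable def CosetCode.margZ {k κ n : ℕ} (C : CosetCode k κ n) (w : Finset (Fin n) → ℝ)
    (z : Fin n → Option (ZMod 2)) : ℝ :=
  ∑ m : Fin k → ZMod 2, C.joint w m z

/-- The `χ²` divergence of distributions on a finite alphabet. A point with `b x = 0`
contributes `0`. -/
noncomputable def chiSq {α : Type*} [Fintype α] (a b : α → ℝ) : ℝ :=
  ∑ x, (a x / b x - 1) ^ 2 * b x

/-- The `χ²` divergence between `p_{MZ}` and `p_M p_Z`, for the law `w` of the revealed set. -/
noncomputable def CosetCode.divergence {k κ n : ℕ} (C : CosetCode k κ n)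
    (w : Finset (Fin n) → ℝ) : ℝ :=
  chiSq (fun x : (Fin k → ZMod 2) × (Fin n → Option (ZMod 2)) => C.joint w x.1 x.2)
    (fun x => C.margM w x.1 * C.margZ w x.2)

/-- `Λ`: the divergence for a fixed number `μ` of revealed bits. -/
noncomputable def CosetCode.Lam {k κ n : ℕ} (C : CosetCode k κ n) (μ : ℕ) : ℝ :=
  C.divergence (fixedLaw n μ)

/-- `λ`: the divergence for a fixed erasure probability `ε`. -/
noncomputable def CosetCode.lam {k κ n : ℕ} (C : CosetCode k κ n) (ε : ℝ) : ℝ :=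
  C.divergence (erasureLaw n ε)

/-- The binary expansion of `i` as a vector of `F_2^κ`, least significant bit first. -/
def binVec (κ : ℕ) (i : Fin (2 ^ κ)) : Fin κ → ZMod 2 :=
  fun j => if (i : ℕ).testBit j then 1 else 0

/-- `q` characterizes the code: `q i` is the fraction of the columns of the generator matrix
that are equal to the binary expansion of `i`. -/
def CosetCode.IsDefinedBy {k κ n : ℕ} (C : CosetCode k κ n) (q : Fin (2 ^ κ) → ℝ) : Prop :=
  ∀ i, q i = ((Finset.univ.filter fun j : Fin n => C.gen.col j = binVec κ i).card : ℝ) / n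

/-- The set of the `d`-dimensional subspaces of `S`; it is empty for negative `d`. -/
noncomputable def Xi {κ : ℕ} (S : Submodule (ZMod 2) (Fin κ → ZMod 2)) (d : ℤ) :
    Finset (Submodule (ZMod 2) (Fin κ → ZMod 2)) :=
  (Set.toFinite {T | T ≤ S ∧ (Module.finrank (ZMod 2) T : ℤ) = d}).toFinset

open Classical in
/-- `ζ(S)`: the fraction of the columns that lie in `S`. -/
noncomputable def zetaFrac {κ : ℕ} (S : Submodule (ZMod 2) (Fin κ → ZMod 2))
    (q : Fin (2 ^ κ) → ℝ) : ℝ :=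
  ∑ i : Fin (2 ^ κ) with binVec κ i ∈ S, q i

/-- `Φ(S, n, μ, q)`. -/
noncomputable def PhiFun {κ : ℕ} (S : Submodule (ZMod 2) (Fin κ → ZMod 2)) (n μ : ℕ)
    (q : Fin (2 ^ κ) → ℝ) : ℝ :=
  ∏ i ∈ Finset.range μ, (zetaFrac S q - (i : ℝ) / n) / (1 - (i : ℝ) / n)

/-- `φ(S, n, ε, q)`, the version with base `ε / (2 - ε)`. -/
noncomputable def varphiFun {κ : ℕ} (S : Submodule (ZMod 2) (Fin κ → ZMod 2)) (n : ℕ)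
    (ε : ℝ) (q : Fin (2 ^ κ) → ℝ) : ℝ :=
  (ε / (2 - ε)) ^ ((n : ℝ) * (1 - zetaFrac S q))

/-!
For a `χ²` divergence, `D + 1` is the expectation of `p_{MZ} / (p_M p_Z)` under the joint law.
Because the encoder is a bijection onto `F_2^n`, the message is uniform and an observation with
revealed set `r` has probability `w r / 2 ^ |r|`. Given a message compatible with it, it has
probability `w r / 2 ^ κ` times the number of `d ∈ F_2^κ` such that `d G` vanishes on `r` (the *ambiguity*
of `r`), since the compatible auxiliary messages form a coset of those `d`. Hence
`D + 1 = ∑ r, w r * 2 ^ |r| / 2 ^ κ * ambiguity r` (`CosetCode.divergence_eq`).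

Apart from `d = 0`, the vectors `d` correspond to the hyperplanes `S = d^⊥` of `F_2^κ`, and `d G`
vanishes on `r` exactly if `r` is contained in the set `J` of the positions whose column lies in
`S`, a set of `n ζ(S)` elements. Exchanging the sums over `r` and `S` leaves
`∑ r ⊆ J, w r * 2 ^ |r| / 2 ^ κ` for each hyperplane, and the same sum with `J` replaced by all
positions for `d = 0` (`CosetCode.divergence_eq_sum_Xi`). These sums are elementary: for `μ`
revealed bits the fraction of the `μ`-element sets that lie in `J` is
`(|J| choose μ) / (n choose μ) = Φ(S)`, and for independent erasures the binomial theorem gives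
`ε ^ (n - |J|) * (2 - ε) ^ |J|`.
-/

open Finset

/-! ### The law of the observation -/

theorem observe_eq_observe_iff {n : ℕ} {r s : Finset (Fin n)} {x y : Fin n → ZMod 2} :
    observe r x = observe s y ↔ r = s ∧ ∀ i ∈ s, x i = y i := by
  constructor
  · intro h
    have hi (i : Fin n) := congrFun h i
    simp only [observe] at hi
    have hrs : r = s := by
      ext i
      have := hi i
      by_cases h1 : i ∈ r <;> by_cases h2 : i ∈ s <;> simp_all
    subst hrs
    refine ⟨rfl, fun i hir => ?_⟩
    simpa [hir] using hi i
  · rintro ⟨rfl, h⟩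
    funext i
    by_cases hir : i ∈ r <;> simp [observe, hir, h]

theorem card_filter_agree {n : ℕ} (r : Finset (Fin n)) (y : Fin n → ZMod 2) :
    (univ.filter fun x : Fin n → ZMod 2 => ∀ i ∈ r, x i = y i).card = 2 ^ (n - r.card) := by
  have h : (univ.filter fun x : Fin n → ZMod 2 => ∀ i ∈ r, x i = y i)
      = Fintype.piFinset fun i => if i ∈ r then {y i} else univ := by
    ext x
    simp only [mem_filter, mem_univ, true_and, Fintype.mem_piFinset]
    refine forall_congr' fun i => ?_
    by_cases hi : i ∈ r <;> simp [hi]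
  rw [h, Fintype.card_piFinset]
  have h2 (i : Fin n) : (if i ∈ r then ({y i} : Finset (ZMod 2)) else univ).card
      = if i ∈ r then 1 else 2 := by
    split_ifs <;> simp [ZMod.card]
  simp only [h2]
  rw [prod_ite, prod_const_one, one_mul, prod_const]
  congr 1
  have h3 : (univ.filter fun i => i ∉ r) = rᶜ := by ext; simp
  rw [h3, card_compl, Fintype.card_fin]

namespace CosetCode

variable {k κ n : ℕ} (C : CosetCode k κ n) {w : Finset (Fin n) → ℝ}

theorem encode_eq_add (m : Fin k → ZMod 2) (m' : Fin κ → ZMod 2) :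
    C.encode m m' = m ᵥ* C.aux + m' ᵥ* C.gen := by
  simp [encode]

theorem bijective_encode :
    Function.Bijective fun p : (Fin k → ZMod 2) × (Fin κ → ZMod 2) => C.encode p.1 p.2 := by
  rw [Fintype.bijective_iff_injective_and_card]
  constructor
  · intro p p' h
    have h2 := Matrix.vecMul_injective_iff.mpr C.indep h
    ext i
    · simpa using congrFun h2 (Sum.inl i)
    · simpa using congrFun h2 (Sum.inr i)
  · simp [ZMod.card, ← pow_add, C.dim_add]

theorem sum_encode (f : (Fin n → ZMod 2) → ℝ) :
    ∑ m, ∑ m', f (C.encode m m') = ∑ x, f x := by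
  rw [← Fintype.sum_prod_type' fun m m' => f (C.encode m m')]
  exact C.bijective_encode.sum_comp f

/-- The number of words `d` with `d G` vanishing at all revealed positions `r`, that is, the size
of the set of auxiliary messages that are compatible with an observation and a message. -/
def ambiguity (r : Finset (Fin n)) : ℕ :=
  (univ.filter fun d : Fin κ → ZMod 2 => ∀ j ∈ r, (d ᵥ* C.gen) j = 0).card

/-- The auxiliary messages compatible with a given one form a coset of the words counted by
the ambiguity. -/
theorem card_filter_encode_agree (r : Finset (Fin n)) (m : Fin k → ZMod 2)
    (m' : Fin κ → ZMod 2) :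
    (univ.filter fun d => ∀ j ∈ r, C.encode m d j = C.encode m m' j).card = C.ambiguity r := by
  refine card_bij' (fun d _ => d - m') (fun d _ => d + m') ?_ ?_ ?_ ?_ <;>
    simp +contextual [encode_eq_add, Matrix.sub_vecMul, Matrix.add_vecMul]

theorem joint_observe (m : Fin k → ZMod 2) (r : Finset (Fin n)) (y : Fin n → ZMod 2) :
    C.joint w m (observe r y) = 1 / 2 ^ k * (1 / 2 ^ κ) * w r *
      ∑ m', if ∀ j ∈ r, C.encode m m' j = y j then 1 else 0 := by
  rw [joint, mul_sum]
  refine sum_congr rfl fun m' _ => ?_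
  simp only [observe_eq_observe_iff, ite_and]
  simp

theorem joint_observe_encode (m : Fin k → ZMod 2) (m' : Fin κ → ZMod 2) (r : Finset (Fin n)) :
    C.joint w m (observe r (C.encode m m'))
      = 1 / 2 ^ k * (1 / 2 ^ κ) * w r * C.ambiguity r := by
  rw [joint_observe, ← C.card_filter_encode_agree r m m', sum_boole]

theorem margZ_observe (r : Finset (Fin n)) (y : Fin n → ZMod 2) :
    C.margZ w (observe r y) = w r / 2 ^ r.card := by
  simp only [margZ, joint_observe, ← mul_sum]
  rw [C.sum_encode fun x => if ∀ j ∈ r, x j = y j then (1 : ℝ) else 0, sum_boole,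
    card_filter_agree]
  have hr : r.card ≤ n := by simpa using r.card_le_univ
  have hpow : (2 : ℝ) ^ k * 2 ^ κ = 2 ^ (n - r.card) * 2 ^ r.card := by
    rw [← pow_add, ← pow_add, C.dim_add, Nat.sub_add_cancel hr]
  rw [one_div_mul_one_div, hpow]
  push_cast
  field_simp

/-- Averaging against the joint law amounts to averaging over the messages and the revealed set,
so no enumeration of the observations is needed. -/
theorem sum_joint_mul (m : Fin k → ZMod 2) (f : (Fin n → Option (ZMod 2)) → ℝ) :
    ∑ z, C.joint w m z * f z
      = ∑ m', ∑ r, 1 / 2 ^ k * (1 / 2 ^ κ) * w r * f (observe r (C.encode m m')) := by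
  simp only [joint, sum_mul, ite_mul, zero_mul]
  rw [sum_comm]
  refine sum_congr rfl fun m' _ => ?_
  rw [sum_comm]
  simp

theorem margM_eq (hw : ∑ r, w r = 1) (m : Fin k → ZMod 2) : C.margM w m = 1 / 2 ^ k := by
  have h := C.sum_joint_mul (w := w) m fun _ => 1
  simp only [mul_one, ← mul_sum, hw] at h
  rw [margM, h]
  simp [ZMod.card]

theorem sum_margZ (hw : ∑ r, w r = 1) : ∑ z, C.margZ w z = 1 := by
  simp only [margZ]
  rw [sum_comm]
  change ∑ m, C.margM w m = 1
  simp [C.margM_eq hw, ZMod.card]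

theorem joint_nonneg (hw0 : ∀ r, 0 ≤ w r) (m : Fin k → ZMod 2) (z : Fin n → Option (ZMod 2)) :
    0 ≤ C.joint w m z := by
  refine sum_nonneg fun m' _ => sum_nonneg fun r _ => ?_
  have := hw0 r
  split_ifs <;> positivity

/-- The quotient `p_{MZ} / (p_M p_Z)` at an observation with revealed set `r` is
`2 ^ (|r| - κ)` times the ambiguity of `r`, and the divergence plus one is its expectation. -/
theorem divergence_eq (hw0 : ∀ r, 0 ≤ w r) (hw : ∑ r, w r = 1) :
    C.divergence w = ∑ r, w r * (2 ^ r.card / 2 ^ κ * C.ambiguity r) - 1 := by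
  have hpt (m : Fin k → ZMod 2) (z : Fin n → Option (ZMod 2)) :
      (C.joint w m z / (C.margM w m * C.margZ w z) - 1) ^ 2 * (C.margM w m * C.margZ w z)
        = C.joint w m z * (2 ^ k * (C.joint w m z / C.margZ w z)) - 2 * C.joint w m z
          + 1 / 2 ^ k * C.margZ w z := by
    rw [C.margM_eq hw]
    -- At the junk value `x / 0 = 0` the identity survives because `p_Z(z) = 0` forces the joint
    -- probability to vanish as well.
    by_cases hz : C.margZ w z = 0
    · have hj : C.joint w m z = 0 :=
        (sum_eq_zero_iff_of_nonneg fun m _ => C.joint_nonneg hw0 m z).mp hz m (mem_univ m)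
      simp [hz, hj]
    · field_simp
      ring
  have hmain (m : Fin k → ZMod 2) :
      ∑ z, C.joint w m z * (2 ^ k * (C.joint w m z / C.margZ w z))
        = 1 / 2 ^ k * ∑ r, w r * (2 ^ r.card / 2 ^ κ * C.ambiguity r) := by
    rw [C.sum_joint_mul m fun z => 2 ^ k * (C.joint w m z / C.margZ w z)]
    simp only [joint_observe_encode, margZ_observe]
    rw [sum_const, card_univ, Fintype.card_fun, ZMod.card, Fintype.card_fin, nsmul_eq_mul,
      mul_sum, mul_sum]
    refine sum_congr rfl fun r _ => ?_
    by_cases hr : w r = 0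
    · simp [hr]
    · push_cast
      field_simp
  have hjoint (m : Fin k → ZMod 2) : ∑ z, C.joint w m z = 1 / 2 ^ k := C.margM_eq hw m
  rw [divergence, chiSq, Fintype.sum_prod_type]
  simp only [hpt, sum_add_distrib, sum_sub_distrib, hmain, ← mul_sum, hjoint, C.sum_margZ hw]
  simp only [sum_const, card_univ, Fintype.card_fun, ZMod.card, Fintype.card_fin, nsmul_eq_mul]
  push_cast
  field_simp
  ring

end CosetCode

/-! ### Nonzero vectors and hyperplanes over the field with two elements -/

/-- Over the field with two elements, a hyperplane is orthogonal to exactly one nonzero vector. -/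
theorem sum_ne_zero_eq_sum_Xi {κ : ℕ} (f : Submodule (ZMod 2) (Fin κ → ZMod 2) → ℝ) :
    ∑ d : Fin κ → ZMod 2 with d ≠ 0, f (LinearMap.ker (dotProductEquiv (ZMod 2) (Fin κ) d))
      = ∑ S ∈ Xi (⊤ : Submodule (ZMod 2) (Fin κ → ZMod 2)) ((κ : ℤ) - 1), f S := by
  have hrank (g : Module.Dual (ZMod 2) (Fin κ → ZMod 2)) (hg : g ≠ 0) :
      Module.finrank (ZMod 2) (LinearMap.ker g) + 1 = κ := by
    simpa using Module.Dual.finrank_ker_add_one_of_ne_zero hg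
  refine sum_bij (fun d _ => LinearMap.ker (dotProductEquiv (ZMod 2) (Fin κ) d)) ?_ ?_ ?_ ?_
  · intro d hd
    have := hrank _ ((dotProductEquiv (ZMod 2) (Fin κ)).map_ne_zero_iff.mpr (by simpa using hd))
    simp only [Xi, Set.Finite.mem_toFinset, Set.mem_ofPred_eq, le_top, true_and]
    omega
  -- Each coordinate of `d` is determined by whether it vanishes.
  · intro d _ d' _ h
    funext i
    have hi := SetLike.ext_iff.mp h (Pi.single i 1)
    simp only [LinearMap.mem_ker, dotProductEquiv_apply_apply, dotProduct_single, mul_one] at hi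
    generalize d i = a at hi
    generalize d' i = b at hi
    revert a b
    decide
  · intro S hS
    simp only [Xi, Set.Finite.mem_toFinset, Set.mem_ofPred_eq, le_top, true_and] at hS
    have hlt : S < ⊤ := by
      rw [lt_top_iff_ne_top]
      rintro rfl
      rw [finrank_top, Module.finrank_fin_fun] at hS
      omega
    obtain ⟨g, hg, hle⟩ := S.exists_le_ker_of_lt_top hlt
    refine ⟨(dotProductEquiv (ZMod 2) (Fin κ)).symm g, by simpa using hg, ?_⟩
    rw [LinearEquiv.apply_symm_apply]
    have := hrank g hg
    exact (Submodule.eq_of_le_of_finrank_eq hle (by omega)).symm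
  · intros; rfl

theorem binVec_bijective (κ : ℕ) : Function.Bijective (binVec κ) := by
  rw [Fintype.bijective_iff_injective_and_card]
  refine ⟨fun a b h => Fin.ext (Nat.eq_of_testBit_eq fun i => ?_), by simp [ZMod.card]⟩
  by_cases hi : i < κ
  · have := congrFun h ⟨i, hi⟩
    simp only [binVec] at this
    cases ha : (a : ℕ).testBit i <;> cases hb : (b : ℕ).testBit i <;> simp_all
  · have hpow : 2 ^ κ ≤ 2 ^ i := Nat.pow_le_pow_right two_pos (not_lt.mp hi)
    rw [Nat.testBit_lt_two_pow (a.2.trans_le hpow), Nat.testBit_lt_two_pow (b.2.trans_le hpow)]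

namespace CosetCode

variable {k κ n : ℕ} (C : CosetCode k κ n)

open Classical in
/-- The positions at which the column of the generator matrix lies in `S`. -/
noncomputable def colsIn (S : Submodule (ZMod 2) (Fin κ → ZMod 2)) : Finset (Fin n) :=
  univ.filter fun j => C.gen.col j ∈ S

/-- A nonzero `d` counted by the ambiguity corresponds to a hyperplane that contains all
the revealed columns. -/
theorem ambiguity_eq (r : Finset (Fin n)) :
    (C.ambiguity r : ℝ) = 1 + ∑ S ∈ Xi (⊤ : Submodule (ZMod 2) (Fin κ → ZMod 2)) ((κ : ℤ) - 1),
      if r ⊆ C.colsIn S then 1 else 0 := by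
  rw [← sum_ne_zero_eq_sum_Xi fun S => if r ⊆ C.colsIn S then (1 : ℝ) else 0, ambiguity,
    ← sum_boole, ← sum_filter_add_sum_filter_not univ (fun d : Fin κ → ZMod 2 => d = 0)]
  congr 1
  · rw [sum_filter]
    simp
  · refine sum_congr rfl fun d _ => ?_
    simp only [subset_iff, colsIn, mem_filter, mem_univ, true_and, LinearMap.mem_ker,
      dotProductEquiv_apply_apply]
    rfl

theorem zetaFrac_eq {q : Fin (2 ^ κ) → ℝ} (hq : C.IsDefinedBy q)
    (S : Submodule (ZMod 2) (Fin κ → ZMod 2)) :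
    zetaFrac S q = (C.colsIn S).card / n := by
  classical
  have h : (C.colsIn S).card = ∑ i : Fin (2 ^ κ) with binVec κ i ∈ S,
      (univ.filter fun j : Fin n => C.gen.col j = binVec κ i).card := by
    let e := Equiv.ofBijective (binVec κ) (binVec_bijective κ)
    have he (j : Fin n) : binVec κ (e.symm (C.gen.col j)) = C.gen.col j :=
      e.apply_symm_apply _
    rw [card_eq_sum_card_fiberwise (f := fun j => e.symm (C.gen.col j))
      (t := univ.filter fun i => binVec κ i ∈ S)]
    · refine sum_congr rfl fun i hi => congrArg card ?_
      ext j
      simp only [colsIn, mem_filter, mem_univ, true_and] at hi ⊢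
      rw [Equiv.symm_apply_eq]
      change C.gen.col j ∈ S ∧ C.gen.col j = binVec κ i ↔ _
      exact ⟨fun h => h.2, fun h => ⟨h ▸ hi, h⟩⟩
    · intro j hj
      simpa [colsIn, he] using hj
  rw [h, zetaFrac]
  push_cast
  rw [sum_div]
  refine sum_congr ?_ fun i _ => hq i
  ext; simp

theorem divergence_eq_sum_Xi {w : Finset (Fin n) → ℝ} (hw0 : ∀ r, 0 ≤ w r)
    (hw : ∑ r, w r = 1) :
    C.divergence w = ∑ r, w r * 2 ^ r.card / 2 ^ κ
      + ∑ S ∈ Xi (⊤ : Submodule (ZMod 2) (Fin κ → ZMod 2)) ((κ : ℤ) - 1),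
          ∑ r ∈ (C.colsIn S).powerset, w r * 2 ^ r.card / 2 ^ κ - 1 := by
  have hS (S : Submodule (ZMod 2) (Fin κ → ZMod 2)) :
      ∑ r ∈ (C.colsIn S).powerset, w r * 2 ^ r.card / 2 ^ κ
        = ∑ r, w r * 2 ^ r.card / 2 ^ κ * if r ⊆ C.colsIn S then 1 else 0 := by
    simp only [mul_ite, mul_one, mul_zero]
    rw [← sum_filter]
    refine sum_congr ?_ fun _ _ => rfl
    ext; simp
  simp only [C.divergence_eq hw0 hw, ambiguity_eq, hS]
  rw [sum_comm, ← sum_add_distrib]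
  congr 1
  refine sum_congr rfl fun r _ => ?_
  rw [← mul_sum]
  ring

end CosetCode

/-! ### Summing the two laws over the subsets of a set of positions -/

theorem fixedLaw_nonneg (n μ : ℕ) (r : Finset (Fin n)) : 0 ≤ fixedLaw n μ r := by
  rw [fixedLaw]; split_ifs <;> positivity

theorem sum_powerset_fixedLaw {n : ℕ} (μ : ℕ) (J : Finset (Fin n)) (f : ℕ → ℝ) :
    ∑ r ∈ J.powerset, fixedLaw n μ r * f r.card
      = (J.card.choose μ : ℝ) / n.choose μ * f μ := by
  simp only [fixedLaw, ite_mul, zero_mul]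
  rw [← sum_filter, ← powersetCard_eq_filter,
    sum_congr rfl (g := fun _ => 1 / (n.choose μ : ℝ) * f μ)]
  · rw [sum_const, card_powersetCard, nsmul_eq_mul]
    ring
  · intro r hr
    rw [(mem_powersetCard.mp hr).2]

theorem erasureLaw_nonneg {ε : ℝ} (h0 : 0 ≤ ε) (h1 : ε ≤ 1) {n : ℕ} (r : Finset (Fin n)) :
    0 ≤ erasureLaw n ε r :=
  mul_nonneg (pow_nonneg h0 _) (pow_nonneg (sub_nonneg.mpr h1) _)

theorem sum_powerset_erasureLaw {n : ℕ} (ε a : ℝ) (J : Finset (Fin n)) :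
    ∑ r ∈ J.powerset, erasureLaw n ε r * a ^ r.card
      = ε ^ (n - J.card) * ((1 - ε) * a + ε) ^ J.card := by
  rw [← sum_pow_mul_eq_add_pow, mul_sum]
  refine sum_congr rfl fun r hr => ?_
  have hrJ := card_le_card (mem_powerset.mp hr)
  have hJ : J.card ≤ n := by simpa using J.card_le_univ
  rw [erasureLaw, mul_pow, show n - r.card = (n - J.card) + (J.card - r.card) by omega, pow_add]
  ring

/-- The product form of `Φ` as a ratio of binomial coefficients. If `c < μ`, both sides vanish. -/
theorem prod_range_sub_div_eq_choose_div {n μ : ℕ} (hμ : μ ≤ n) (c : ℕ) :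
    ∏ i ∈ range μ, ((c : ℝ) / n - (i : ℝ) / n) / (1 - (i : ℝ) / n)
      = (c.choose μ : ℝ) / n.choose μ := by
  induction μ with
  | zero => simp
  | succ μ ih =>
    have hn : (n : ℝ) ≠ 0 := by exact_mod_cast (by omega : n ≠ 0)
    have hlt : (μ : ℝ) < n := by exact_mod_cast hμ
    have hnμ : (n : ℝ) - μ ≠ 0 := (sub_pos.mpr hlt).ne'
    have hrec (a : ℕ) : (a.choose (μ + 1) : ℝ) * (μ + 1) = a.choose μ * (a - μ) := by
      rcases le_or_gt μ a with h | h
      · have := Nat.choose_succ_right_eq a μ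
        rw [← Nat.cast_sub h]
        exact_mod_cast this
      · simp [Nat.choose_eq_zero_of_lt h, Nat.choose_eq_zero_of_lt (h.trans (Nat.lt_succ_self μ))]
    have hch : (n.choose μ : ℝ) ≠ 0 := by
      exact_mod_cast (Nat.choose_pos (Nat.le_of_succ_le hμ)).ne'
    have hμ1 : (μ : ℝ) + 1 ≠ 0 := by positivity
    rw [prod_range_succ, ih (Nat.le_of_succ_le hμ), ← mul_div_mul_right (c.choose (μ + 1) : ℝ) _ hμ1,
      hrec, hrec, ← mul_div_mul_comm, ← mul_div_mul_right _ _ hn]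
    congr 1 <;> field_simp

theorem theorem5 {k κ n : ℕ} (hn : 0 < n) (C : CosetCode k κ n) (q : Fin (2 ^ κ) → ℝ)
    (hq : C.IsDefinedBy q) :
    (∀ μ : ℕ, μ ≤ n →
      C.Lam μ = (2 : ℝ) ^ ((μ : ℤ) - (κ : ℤ)) *
        (1 + ∑ S ∈ Xi (⊤ : Submodule (ZMod 2) (Fin κ → ZMod 2)) ((κ : ℤ) - 1),
          PhiFun S n μ q) - 1) ∧
    (∀ ε : ℝ, 0 ≤ ε → ε ≤ 1 →
      C.lam ε = (2 - ε) ^ n * (2 : ℝ) ^ (-(κ : ℤ)) *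
        (1 + ∑ S ∈ Xi (⊤ : Submodule (ZMod 2) (Fin κ → ZMod 2)) ((κ : ℤ) - 1),
          varphiFun S n ε q) - 1) := by
  have hn' : (n : ℝ) ≠ 0 := by exact_mod_cast hn.ne'
  constructor
  · intro μ hμ
    have hch : (n.choose μ : ℝ) ≠ 0 := by exact_mod_cast (Nat.choose_pos hμ).ne'
    have hw : ∑ r, fixedLaw n μ r = 1 := by
      have := sum_powerset_fixedLaw μ (univ : Finset (Fin n)) fun _ => 1
      simpa [hch] using this
    have hS (J : Finset (Fin n)) : ∑ r ∈ J.powerset, fixedLaw n μ r * 2 ^ r.card / 2 ^ κ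
        = 2 ^ ((μ : ℤ) - (κ : ℤ)) * ((J.card.choose μ : ℝ) / n.choose μ) := by
      simp only [mul_div_assoc]
      rw [sum_powerset_fixedLaw μ J fun c => 2 ^ c / 2 ^ κ, zpow_sub₀ two_ne_zero, zpow_natCast,
        zpow_natCast]
      ring
    have htop := hS univ
    rw [powerset_univ, card_univ, Fintype.card_fin, div_self hch, mul_one] at htop
    simp only [CosetCode.Lam, C.divergence_eq_sum_Xi (fixedLaw_nonneg n μ) hw, htop, hS, PhiFun,
      C.zetaFrac_eq hq, prod_range_sub_div_eq_choose_div hμ, ← mul_sum]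
    ring
  · intro ε h0 h1
    have h2 : 2 - ε ≠ 0 := by linarith
    have hw : ∑ r, erasureLaw n ε r = 1 := by
      have := sum_powerset_erasureLaw ε 1 (univ : Finset (Fin n))
      simpa using this
    have hS (J : Finset (Fin n)) : ∑ r ∈ J.powerset, erasureLaw n ε r * 2 ^ r.card / 2 ^ κ
        = (2 - ε) ^ n * 2 ^ (-(κ : ℤ)) * (ε / (2 - ε)) ^ (n - J.card) := by
      have hJ : J.card ≤ n := by simpa using J.card_le_univ
      rw [← sum_div, sum_powerset_erasureLaw, show (1 - ε) * 2 + ε = 2 - ε by ring, zpow_neg,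
        zpow_natCast, div_pow, ← div_eq_mul_inv]
      have : (2 - ε) ^ n = (2 - ε) ^ (n - J.card) * (2 - ε) ^ J.card := by
        rw [← pow_add, Nat.sub_add_cancel hJ]
      rw [this]
      field_simp
    have hφ (S : Submodule (ZMod 2) (Fin κ → ZMod 2)) :
        varphiFun S n ε q = (ε / (2 - ε)) ^ (n - (C.colsIn S).card) := by
      have hJ : (C.colsIn S).card ≤ n := by simpa using (C.colsIn S).card_le_univ
      rw [varphiFun, C.zetaFrac_eq hq, ← Real.rpow_natCast, Nat.cast_sub hJ]
      congr 1
      field_simp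
    have htop := hS univ
    rw [powerset_univ, card_univ, Fintype.card_fin, Nat.sub_self, pow_zero, mul_one] at htop
    simp only [CosetCode.lam, C.divergence_eq_sum_Xi (erasureLaw_nonneg h0 h1) hw, htop, hS, hφ,
      ← mul_sum]
    ring
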